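/- **Theorem 4.2 (Triple Normal Intersection Theorem).** Let $\gamma:\mathbb R\to\mathbb R^2$ be a regular $C^2$ parametrization of a closed plane curve, that is, $\gamma$ is twice continuously differentiable, periodic with some period $L>0$, and $\gamma'(t)\neq 0$ for all $t$; self-intersections are allowed. For each $t$, the normal line to $\gamma$ at $\gamma(t)$ is the line through $\gamma(t)$ orthogonal to $\gamma'(t)$. Let $\theta_1,\theta_2,\theta_3<\pi$ be real numbers with $\theta_1+\theta_2+\theta_3=2\pi$ (so that each $\theta_i$ is positive). Then there are three normal lines $\ell_1,\ell_2,\ell_3$ to $\gamma$ that pass through a common point $P$ and form the angles $\theta_1,\theta_2,\theta_3$ there: one can choose points $Q_i\in\ell_i\setminus\{P\}$, $i=1,2,3$, such that $$\angle Q_2PQ_3=\theta_1,\qquad \angle Q_3PQ_1=\theta_2,\qquad \angle Q_1PQ_2=\theta_3 .$$ -/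

import Mathlib

/-- The Euclidean plane. -/
abbrev Plane : Type := EuclideanSpace ℝ (Fin 2)

/-- `γ : ℝ → Plane` is a periodic, regular, twice continuously differentiable parametrization of a
closed plane curve with period `L`. The curve is only immersed: self-intersections and points of
vanishing or changing curvature are allowed. -/
structure IsClosedC2Curve (γ : ℝ → Plane) (L : ℝ) : Prop where
  period_pos : 0 < L
  periodic : Function.Periodic γ L
  contDiff : ContDiff ℝ 2 γ
  regular : ∀ t, deriv γ t ≠ 0

/-- The normal line to `γ` at the parameter `t`: the set of points `γ t + v` with `v` orthogonal to
the velocity `γ' t`. -/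
noncomputable def normalLine (γ : ℝ → Plane) (t : ℝ) : AffineSubspace ℝ Plane :=
  AffineSubspace.mk' (γ t) (Submodule.span ℝ {deriv γ t})ᗮ

/-- `ℓ` is a normal line to the curve `γ`. -/
def IsNormalTo (ℓ : AffineSubspace ℝ Plane) (γ : ℝ → Plane) : Prop :=
  ∃ t : ℝ, ℓ = normalLine γ t

/-- The three lines `ℓ₁, ℓ₂, ℓ₃` meet at the point `P` and form there the angles `θ₁, θ₂, θ₃`:
one can choose on each line `ℓᵢ` a ray from `P` (through a point `Qᵢ ≠ P`) so that the angles
between the pairs of these rays are `θ₁, θ₂, θ₃`. When `θ₁ + θ₂ + θ₃ = 2π`, these are the three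
consecutive sectors into which the rays cut the plane around `P`. -/
def MeetFormingAngles (ℓ₁ ℓ₂ ℓ₃ : AffineSubspace ℝ Plane) (P : Plane) (θ₁ θ₂ θ₃ : ℝ) : Prop :=
  P ∈ ℓ₁ ∧ P ∈ ℓ₂ ∧ P ∈ ℓ₃ ∧
    ∃ Q₁ ∈ ℓ₁, ∃ Q₂ ∈ ℓ₂, ∃ Q₃ ∈ ℓ₃, Q₁ ≠ P ∧ Q₂ ≠ P ∧ Q₃ ≠ P ∧
      EuclideanGeometry.angle Q₂ P Q₃ = θ₁ ∧
      EuclideanGeometry.angle Q₃ P Q₁ = θ₂ ∧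
      EuclideanGeometry.angle Q₁ P Q₂ = θ₃

open Real

/-! Take directions `φ`, `φ + θ₃`, `φ - θ₂`, bounding sectors `θ₁, θ₂, θ₃`, and maximize over `t₁,
t₂, t₃, φ` the sum of `sin θᵢ` times the component of `γ tᵢ` in the `i`-th direction; periodicity
supplies compactness. Stationarity in `tᵢ` makes the `i`-th direction normal to `γ` at `tᵢ`.
Stationarity in `φ` makes the three normals concurrent: by `sin_smul_unitVec_add_eq_zero` the
weighted signed distances from any point `P` to them then sum to zero, so the intersection of two
lies on the third. -/

/-- The unit vector of the plane at the angle `φ` to the first axis. -/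
noncomputable def unitVec (φ : ℝ) : Plane := !₂[cos φ, sin φ]

theorem Plane.inner_eq (v w : Plane) : inner ℝ v w = v 0 * w 0 + v 1 * w 1 := by
  simp [PiLp.inner_apply, Fin.sum_univ_two, mul_comm]

theorem unitVec_periodic : Function.Periodic unitVec (2 * π) := fun φ => by
  simp [unitVec]

theorem inner_unitVec_unitVec (α β : ℝ) : inner ℝ (unitVec α) (unitVec β) = cos (α - β) := by
  simp [Plane.inner_eq, unitVec, cos_sub]

theorem norm_unitVec (φ : ℝ) : ‖unitVec φ‖ = 1 := by
  simp [EuclideanSpace.norm_eq, Fin.sum_univ_two, unitVec]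

theorem unitVec_ne_zero (φ : ℝ) : unitVec φ ≠ 0 := fun h => by
  simpa [h] using norm_unitVec φ

theorem hasDerivAt_unitVec (φ : ℝ) : HasDerivAt unitVec (unitVec (φ + π / 2)) φ := by
  have : HasDerivAt (fun φ : ℝ => ![cos φ, sin φ]) ![-sin φ, cos φ] φ := by
    rw [hasDerivAt_pi]
    intro i
    fin_cases i
    · exact hasDerivAt_cos φ
    · exact hasDerivAt_sin φ
  have h := (PiLp.continuousLinearEquiv 2 ℝ (fun _ : Fin 2 => ℝ)).symm.hasFDerivAt.comp_hasDerivAt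
    φ this
  rw [unitVec, cos_add_pi_div_two, sin_add_pi_div_two]
  exact h

theorem continuous_unitVec : Continuous unitVec :=
  continuous_iff_continuousAt.2 fun φ => (hasDerivAt_unitVec φ).continuousAt

theorem angle_unitVec {α β θ : ℝ} (h₀ : 0 ≤ θ) (h₁ : θ ≤ π) (h : cos (α - β) = cos θ) :
    InnerProductGeometry.angle (unitVec α) (unitVec β) = θ := by
  rw [InnerProductGeometry.angle, inner_unitVec_unitVec, norm_unitVec, norm_unitVec, h]
  simpa using arccos_cos h₀ h₁

/-- Unit vectors weighted by the sines of the opposite sectors add up to zero. -/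
theorem sin_smul_unitVec_add_eq_zero {θ₁ θ₂ θ₃ : ℝ} (hsum : θ₁ + θ₂ + θ₃ = 2 * π) (φ : ℝ) :
    sin θ₁ • unitVec φ + sin θ₂ • unitVec (φ + θ₃) + sin θ₃ • unitVec (φ - θ₂) = 0 := by
  have h : sin θ₁ = -(sin θ₂ * cos θ₃ + cos θ₂ * sin θ₃) := by
    rw [← sin_add, show θ₁ = 2 * π - (θ₂ + θ₃) by linarith, sin_two_pi_sub]
  ext i
  fin_cases i
  · simp only [unitVec, h, cos_add, cos_sub, Fin.zero_eta, PiLp.add_apply, PiLp.smul_apply,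
      PiLp.zero_apply, Matrix.cons_val_zero, smul_eq_mul]
    ring
  · simp only [unitVec, h, sin_add, sin_sub, Fin.mk_one, PiLp.add_apply, PiLp.smul_apply,
      PiLp.zero_apply, Matrix.cons_val_one, Matrix.cons_val_zero, smul_eq_mul]
    ring

theorem mem_normalLine_iff {γ : ℝ → Plane} {t : ℝ} {P : Plane} :
    P ∈ normalLine γ t ↔ inner ℝ (deriv γ t) (P - γ t) = 0 := by
  rw [normalLine, AffineSubspace.mem_mk', vsub_eq_sub, Submodule.mem_orthogonal_singleton_iff_inner_right]

/-- If `unitVec φ` is normal to the curve at `t`, a point belongs to the normal line at `t` as soon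
as it differs from `γ t` by a vector orthogonal to the rotated vector `unitVec (φ + π / 2)`. -/
theorem mem_normalLine_of_inner_eq_zero {γ : ℝ → Plane} {t φ : ℝ} {P : Plane}
    (hn : inner ℝ (deriv γ t) (unitVec φ) = 0)
    (hP : inner ℝ (P - γ t) (unitVec (φ + π / 2)) = 0) : P ∈ normalLine γ t := by
  rw [mem_normalLine_iff]
  simp only [Plane.inner_eq, unitVec, cos_add_pi_div_two, sin_add_pi_div_two,
    Matrix.cons_val_zero, Matrix.cons_val_one] at *
  -- This expands the inner product of `deriv γ t` and `P - γ t` in the orthonormal basis `unitVec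
  -- φ`, `unitVec (φ + π / 2)`; each term has a vanishing factor.
  linear_combination ((P - γ t) 0 * cos φ + (P - γ t) 1 * sin φ) * hn +
    (-deriv γ t 0 * sin φ + deriv γ t 1 * cos φ) * hP -
    (deriv γ t 0 * (P - γ t) 0 + deriv γ t 1 * (P - γ t) 1) * sin_sq_add_cos_sq φ

theorem add_unitVec_mem_normalLine {γ : ℝ → Plane} {t φ : ℝ} {P : Plane}
    (hP : P ∈ normalLine γ t) (hn : inner ℝ (deriv γ t) (unitVec φ) = 0) :
    P + unitVec φ ∈ normalLine γ t := by
  rw [mem_normalLine_iff] at *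
  rw [add_sub_right_comm, inner_add_right, hP, hn, add_zero]

/-- A continuous function of four variables, periodic in each of them, attains a global maximum. -/
theorem exists_forall_le_of_periodic {F : ℝ × ℝ × ℝ × ℝ → ℝ} (hF : Continuous F) {L M : ℝ}
    (hL : 0 < L) (hM : 0 < M) (h₁ : ∀ b c d, Function.Periodic (fun a => F (a, b, c, d)) L)
    (h₂ : ∀ a c d, Function.Periodic (fun b => F (a, b, c, d)) L)
    (h₃ : ∀ a b d, Function.Periodic (fun c => F (a, b, c, d)) L)
    (h₄ : ∀ a b c, Function.Periodic (fun d => F (a, b, c, d)) M) :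
    ∃ p, ∀ q, F q ≤ F p := by
  have hK : IsCompact (Set.Icc 0 L ×ˢ Set.Icc 0 L ×ˢ Set.Icc 0 L ×ˢ Set.Icc 0 M) :=
    isCompact_Icc.prod (isCompact_Icc.prod (isCompact_Icc.prod isCompact_Icc))
  obtain ⟨p, -, hp⟩ := hK.exists_isMaxOn ⟨(0, 0, 0, 0), by simp [hL.le, hM.le]⟩ hF.continuousOn
  refine ⟨p, fun ⟨a, b, c, d⟩ => ?_⟩
  obtain ⟨a', ha', ha⟩ := (h₁ b c d).exists_mem_Ico₀ hL a
  obtain ⟨b', hb', hb⟩ := (h₂ a' c d).exists_mem_Ico₀ hL b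
  obtain ⟨c', hc', hc⟩ := (h₃ a' b' d).exists_mem_Ico₀ hL c
  obtain ⟨d', hd', hd⟩ := (h₄ a' b' c').exists_mem_Ico₀ hM d
  rw [ha, hb, hc, hd]
  exact hp ⟨Set.Ico_subset_Icc_self ha', Set.Ico_subset_Icc_self hb',
    Set.Ico_subset_Icc_self hc', Set.Ico_subset_Icc_self hd'⟩

/-- The size of the triangle with outer normals `unitVec φ`, `unitVec (φ + α)`, `unitVec (φ + β)`
whose sides pass through three points of the curve has a critical point: the directions are normal
to the curve at these points, and the size is stationary under rotation of the directions. -/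
theorem exists_critical_triangle {γ : ℝ → Plane} {L : ℝ} (hγ : IsClosedC2Curve γ L)
    {a₁ a₂ a₃ : ℝ} (ha₁ : a₁ ≠ 0) (ha₂ : a₂ ≠ 0) (ha₃ : a₃ ≠ 0) (α β : ℝ) :
    ∃ t₁ t₂ t₃ φ : ℝ, inner ℝ (deriv γ t₁) (unitVec φ) = 0 ∧
      inner ℝ (deriv γ t₂) (unitVec (φ + α)) = 0 ∧
      inner ℝ (deriv γ t₃) (unitVec (φ + β)) = 0 ∧
      a₁ * inner ℝ (γ t₁) (unitVec (φ + π / 2)) + a₂ * inner ℝ (γ t₂) (unitVec (φ + α + π / 2)) +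
        a₃ * inner ℝ (γ t₃) (unitVec (φ + β + π / 2)) = 0 := by
  let F : ℝ × ℝ × ℝ × ℝ → ℝ := fun p => a₁ * inner ℝ (γ p.1) (unitVec p.2.2.2) +
    a₂ * inner ℝ (γ p.2.1) (unitVec (p.2.2.2 + α)) +
    a₃ * inner ℝ (γ p.2.2.1) (unitVec (p.2.2.2 + β))
  have hγc : Continuous γ := hγ.contDiff.continuous
  have huc := continuous_unitVec
  have hγd : ∀ t, HasDerivAt γ (deriv γ t) t := fun t =>
    (hγ.contDiff.differentiable (by norm_num) t).hasDerivAt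
  -- With the other variables frozen, their terms form the constant `c`; the nonzero weight `a`
  -- cancels from the derivative.
  have hcrit : ∀ (t : ℝ) (v : Plane) (a c : ℝ), a ≠ 0 →
      (∀ s, a * inner ℝ (γ s) v + c ≤ a * inner ℝ (γ t) v + c) →
      inner ℝ (deriv γ t) v = 0 := by
    intro t v a c ha hmax
    have hd := (((hγd t).inner ℝ (hasDerivAt_const t v)).const_mul a).add_const c
    have h0 := IsLocalMax.hasDerivAt_eq_zero (Filter.Eventually.of_forall hmax) hd
    simpa [ha] using h0
  obtain ⟨⟨t₁, t₂, t₃, φ⟩, hmax⟩ := exists_forall_le_of_periodic (F := F) (by fun_prop)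
    hγ.period_pos two_pi_pos
    (fun b c d a => by simp only [F, hγ.periodic a]) (fun a c d b => by simp only [F, hγ.periodic b])
    (fun a b d c => by simp only [F, hγ.periodic c])
    (fun a b c d => by
      simp only [F, unitVec_periodic d, add_right_comm d (2 * π), unitVec_periodic (d + α),
        unitVec_periodic (d + β)])
  refine ⟨t₁, t₂, t₃, φ, ?_, ?_, ?_, ?_⟩
  · refine hcrit t₁ _ a₁ (a₂ * inner ℝ (γ t₂) (unitVec (φ + α)) +
      a₃ * inner ℝ (γ t₃) (unitVec (φ + β))) ha₁ fun s => ?_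
    linarith [hmax (s, t₂, t₃, φ)]
  · refine hcrit t₂ _ a₂ (a₁ * inner ℝ (γ t₁) (unitVec φ) +
      a₃ * inner ℝ (γ t₃) (unitVec (φ + β))) ha₂ fun s => ?_
    linarith [hmax (t₁, s, t₃, φ)]
  · refine hcrit t₃ _ a₃ (a₁ * inner ℝ (γ t₁) (unitVec φ) +
      a₂ * inner ℝ (γ t₂) (unitVec (φ + α))) ha₃ fun s => ?_
    linarith [hmax (t₁, t₂, s, φ)]
  · have hd : ∀ (a : ℝ) (v : Plane) (δ : ℝ), HasDerivAt (fun φ => a * inner ℝ v (unitVec (φ + δ)))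
        (a * inner ℝ v (unitVec (φ + δ + π / 2))) φ := fun a v δ => by
      simpa using ((hasDerivAt_const φ v).inner ℝ
        ((hasDerivAt_unitVec (φ + δ)).comp_add_const φ δ)).const_mul a
    have hd₁ := hd a₁ (γ t₁) 0
    simp only [add_zero] at hd₁
    exact IsLocalMax.hasDerivAt_eq_zero
      (Filter.Eventually.of_forall fun ψ => hmax (t₁, t₂, t₃, ψ))
      ((hd₁.add (hd a₂ (γ t₂) α)).add (hd a₃ (γ t₃) β))

theorem theorem4p2 (γ : ℝ → Plane) (L : ℝ) (hγ : IsClosedC2Curve γ L)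
    (θ₁ θ₂ θ₃ : ℝ) (h₁ : θ₁ < Real.pi) (h₂ : θ₂ < Real.pi) (h₃ : θ₃ < Real.pi)
    (hsum : θ₁ + θ₂ + θ₃ = 2 * Real.pi) :
    ∃ ℓ₁ ℓ₂ ℓ₃ : AffineSubspace ℝ Plane,
      IsNormalTo ℓ₁ γ ∧ IsNormalTo ℓ₂ γ ∧ IsNormalTo ℓ₃ γ ∧
        ∃ P : Plane, MeetFormingAngles ℓ₁ ℓ₂ ℓ₃ P θ₁ θ₂ θ₃ := by
  have p₁ : 0 < θ₁ := by linarith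
  have p₂ : 0 < θ₂ := by linarith
  have p₃ : 0 < θ₃ := by linarith
  have s₁ := (sin_pos_of_pos_of_lt_pi p₁ h₁).ne'
  have s₂ := (sin_pos_of_pos_of_lt_pi p₂ h₂).ne'
  have s₃ := (sin_pos_of_pos_of_lt_pi p₃ h₃).ne'
  obtain ⟨t₁, t₂, t₃, φ, n₁, n₂, n₃, hrot⟩ := exists_critical_triangle hγ s₁ s₂ s₃ θ₃ (-θ₂)
  rw [← sub_eq_add_neg] at n₃ hrot
  -- The first two normals are not parallel, since `sin θ₃ ≠ 0`; `s` locates their intersection on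
  -- the first.
  obtain ⟨s, hs⟩ : ∃ s : ℝ, inner ℝ (γ t₁ + s • unitVec φ - γ t₂) (unitVec (φ + θ₃ + π / 2)) = 0 := by
    refine ⟨inner ℝ (γ t₁ - γ t₂) (unitVec (φ + θ₃ + π / 2)) / sin θ₃, ?_⟩
    rw [add_sub_right_comm, inner_add_left, real_inner_smul_left, inner_unitVec_unitVec,
      show φ - (φ + θ₃ + π / 2) = -(θ₃ + π / 2) by ring, cos_neg, cos_add_pi_div_two]
    field_simp
    ring
  set P := γ t₁ + s • unitVec φ with hP
  have e₁ : inner ℝ (P - γ t₁) (unitVec (φ + π / 2)) = 0 := by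
    rw [hP, add_sub_cancel_left, real_inner_smul_left, inner_unitVec_unitVec]
    simp
  have e₃ : inner ℝ (P - γ t₃) (unitVec (φ - θ₂ + π / 2)) = 0 := by
    -- Pairing the rotated relation with `P` removes `P` from the weighted sum, leaving exactly
    -- `hrot`.
    have hz := congrArg (inner ℝ P) (sin_smul_unitVec_add_eq_zero hsum (φ + π / 2))
    rw [show φ + π / 2 + θ₃ = φ + θ₃ + π / 2 by ring,
      show φ + π / 2 - θ₂ = φ - θ₂ + π / 2 by ring] at hz
    simp only [inner_add_right, real_inner_smul_right, inner_zero_right] at hz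
    rw [inner_sub_left] at *
    refine (mul_eq_zero.1 ?_).resolve_left s₃
    linear_combination hz - hrot - sin θ₁ * e₁ - sin θ₂ * hs
  have m₁ := mem_normalLine_of_inner_eq_zero n₁ e₁
  have m₂ := mem_normalLine_of_inner_eq_zero n₂ hs
  have m₃ := mem_normalLine_of_inner_eq_zero n₃ e₃
  refine ⟨_, _, _, ⟨t₁, rfl⟩, ⟨t₂, rfl⟩, ⟨t₃, rfl⟩, P, m₁, m₂, m₃,
    _, add_unitVec_mem_normalLine m₁ n₁, _, add_unitVec_mem_normalLine m₂ n₂,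
    _, add_unitVec_mem_normalLine m₃ n₃, by simp [unitVec_ne_zero], by simp [unitVec_ne_zero],
    by simp [unitVec_ne_zero], ?_, ?_, ?_⟩ <;>
  simp only [EuclideanGeometry.angle, vsub_eq_sub, add_sub_cancel_left]
  · refine angle_unitVec p₁.le h₁.le ?_
    rw [show φ + θ₃ - (φ - θ₂) = 2 * π - θ₁ by linarith, cos_two_pi_sub]
  · refine angle_unitVec p₂.le h₂.le ?_
    rw [show φ - θ₂ - φ = -θ₂ by ring, cos_neg]
  · refine angle_unitVec p₃.le h₃.le ?_
    rw [show φ - (φ + θ₃) = -θ₃ by ring, cos_neg]
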